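/- Let $q=2^m$ with $m\ge 1$, let $\mathbb{F}_q$ be the field with $q$ elements, and let $\psi$ be a nontrivial (complex-valued) additive character of $\mathbb{F}_q$. Let $\operatorname{Tr}$ be the trace of a square matrix, ${}^tA$ the transpose of $A$, and call a square matrix $B$ over $\mathbb{F}_q$ alternating if $b_{ii}=0$ and $b_{ij}=-b_{ji}$ for all $i,j$. For $n\ge 1$ and $0\le r\le n$ put $$P^+(2n,q)=\left\{\begin{bmatrix}A&0\\0&{}^tA^{-1}\end{bmatrix}\begin{bmatrix}1_n&B\\0&1_n\end{bmatrix}\ :\ A\in GL(n,q),\ B \text{ alternating}\right\},\qquad \sigma_r^+=\begin{bmatrix}0&0&1_r&0\\0&1_{n-r}&0&0\\1_r&0&0&0\\0&0&0&1_{n-r}\end{bmatrix},$$ $$DC_1^{\pm}(n,q)=P^+(2n,q)\,\sigma_{n-1}^+\,P^+(2n,q),\qquad DC_2^{\pm}(n,q)=P^+(2n,q)\,\sigma_{n-2}^+\,P^+(2n,q),$$ where $DC_1^+$ and $DC_2^+$ are considered for even $n\ge 2$, $DC_1^-$ for odd $n\ge 1$, and $DC_2^-$ for odd $n\ge 3$.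 Let $$K(\psi;1)=\sum_{x\in\mathbb{F}_q^*}\psi(x+x^{-1}),\qquad K_{GL(2,q)}(\psi;1)=\sum_{w\in GL(2,q)}\psi(\operatorname{Tr}w+\operatorname{Tr}w^{-1}).$$ With $\left[{n\atop r}\right]_q=\prod_{j=0}^{r-1}\frac{q^{n-j}-1}{q^{r-j}-1}$, let $$A_1^+(n,q)=q^{\frac14(5n^2-6n)}\left[{n\atop 1}\right]_q\prod_{j=1}^{n/2}(q^{2j-1}-1),\qquad A_2^+(n,q)=q^{\frac14(5n^2-6n)}\left[{n\atop 2}\right]_q\prod_{j=1}^{(n-2)/2}(q^{2j-1}-1),$$ $$A_1^-(n,q)=q^{\frac14(5n^2-4n-1)}\left[{n\atop 1}\right]_q\prod_{j=1}^{(n-1)/2}(q^{2j-1}-1),\qquad A_2^-(n,q)=q^{\frac14(5n^2-8n+3)}\left[{n\atop 2}\right]_q\prod_{j=1}^{(n-1)/2}(q^{2j-1}-1).$$ Then, with either all upper or all lower signs, and for all $n$ for which the double coset in question is considered, $$\sum_{w\in DC_1^{\pm}(n,q)}\psi(\operatorname{Tr}w)=A_1^{\pm}(n,q)\,K(\psi;1),$$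 $$\sum_{w\in DC_2^{\pm}(n,q)}\psi(\operatorname{Tr}w)=q^{-1}A_2^{\pm}(n,q)\,K_{GL(2,q)}(\psi;1)=A_2^{\pm}(n,q)\left(K(\psi;1)^2+q^2-q\right).$$ -/

import Mathlib

open Matrix

noncomputable section

namespace OrthogonalExpSum

/-- A square matrix is alternating if it has zero diagonal and `B i j = -B j i` for all `i`, `j`. -/
def IsAlternating {n : ℕ} {F : Type*} [Field F] (B : Matrix (Fin n) (Fin n) F) : Prop :=
  (∀ i, B i i = 0) ∧ ∀ i j, B i j = -B j i

/-- The maximal parabolic subgroup `P⁺(2n,q)` of `O⁺(2n,q)`, as a set of `2n × 2n` matrices: the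
products `[A 0; 0 ᵗA⁻¹] [1 B; 0 1]` with `A ∈ GL(n,q)` and `B` alternating. The rows and columns of
a `2n × 2n` matrix are indexed by `Fin n ⊕ Fin n`. -/
def parabolic (n : ℕ) (F : Type*) [Field F] : Set (Matrix (Fin n ⊕ Fin n) (Fin n ⊕ Fin n) F) :=
  {w | ∃ (A : GL (Fin n) F) (B : Matrix (Fin n) (Fin n) F), IsAlternating B ∧
    w = fromBlocks (A : Matrix (Fin n) (Fin n) F) 0 0 ((A⁻¹ : GL (Fin n) F) : Matrix (Fin n) (Fin n) F)ᵀ *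
      fromBlocks 1 B 0 1}

/-- The matrix `σ_r⁺` (`0 ≤ r ≤ n`), which interchanges the coordinates `i` and `n + i` for
`i = 1, …, r` and fixes the other coordinates: its four `n × n` blocks are
`[0 0; 0 1_{n-r}]`, `[1_r 0; 0 0]`, `[1_r 0; 0 0]`, `[0 0; 0 1_{n-r}]`. -/
def sigma (n r : ℕ) (F : Type*) [Field F] : Matrix (Fin n ⊕ Fin n) (Fin n ⊕ Fin n) F :=
  fromBlocks
    (diagonal fun i : Fin n => if (i : ℕ) < r then 0 else 1)
    (diagonal fun i : Fin n => if (i : ℕ) < r then 1 else 0)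
    (diagonal fun i : Fin n => if (i : ℕ) < r then 1 else 0)
    (diagonal fun i : Fin n => if (i : ℕ) < r then 0 else 1)

/-- The double coset `P⁺ σ_{n-1}⁺ P⁺`: it is `DC₁⁺(n,q)` for `n = 2, 4, 6, …` and `DC₁⁻(n,q)` for
`n = 1, 3, 5, …`. -/
def DC₁ (n : ℕ) (F : Type*) [Field F] : Set (Matrix (Fin n ⊕ Fin n) (Fin n ⊕ Fin n) F) :=
  DoubleCoset.doubleCoset (sigma n (n - 1) F) (parabolic n F) (parabolic n F)

/-- The double coset `P⁺ σ_{n-2}⁺ P⁺`: it is `DC₂⁺(n,q)` for `n = 2, 4, 6, …` and `DC₂⁻(n,q)` for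
`n = 3, 5, 7, …`. -/
def DC₂ (n : ℕ) (F : Type*) [Field F] : Set (Matrix (Fin n ⊕ Fin n) (Fin n ⊕ Fin n) F) :=
  DoubleCoset.doubleCoset (sigma n (n - 2) F) (parabolic n F) (parabolic n F)

/-- The sum of `ψ (Tr w)` over all `w` in a set `S` of `m × m` matrices (a finite set). -/
def traceSum {m F : Type*} [Fintype m] [DecidableEq m] [Field F] [Fintype F]
    (ψ : AddChar F ℂ) (S : Set (Matrix m m F)) : ℂ :=
  ∑ w ∈ S.toFinite.toFinset, ψ w.trace

/-- The Kloosterman sum `K(ψ;a)`, the sum of `ψ(x + a x⁻¹)` over all `x ∈ F_q^*`. -/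
def kloosterman {F : Type*} [Field F] [Fintype F] [DecidableEq F] (ψ : AddChar F ℂ) (a : F) : ℂ :=
  ∑ x : Fˣ, ψ ((x : F) + a * ((x⁻¹ : Fˣ) : F))

/-- The Kloosterman sum `K_{GL(t,q)}(ψ;a)`, the sum of `ψ(Tr w + a Tr w⁻¹)` over all
`w ∈ GL(t,q)`. -/
def kloostermanGL (t : ℕ) {F : Type*} [Field F] [Fintype F] [DecidableEq F]
    (ψ : AddChar F ℂ) (a : F) : ℂ :=
  ∑ w : GL (Fin t) F, ψ ((w : Matrix (Fin t) (Fin t) F).trace +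
    a * ((w⁻¹ : GL (Fin t) F) : Matrix (Fin t) (Fin t) F).trace)

/-- The `q`-binomial coefficient for `0 ≤ r ≤ n` (and `q ≥ 2`), the product of
`(q^(n-j) - 1) / (q^(r-j) - 1)` over `j = 0, …, r - 1`. -/
def qBinom (n r q : ℕ) : ℚ :=
  ∏ j ∈ Finset.range r, ((q : ℚ) ^ (n - j) - 1) / ((q : ℚ) ^ (r - j) - 1)

/-- `A₁⁺(n,q)`, for even `n ≥ 2`; the exponent is then a natural number, so that the subtraction
and the division by 4 are exact. -/
def A₁plus (n q : ℕ) : ℚ :=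
  (q : ℚ) ^ ((5 * n ^ 2 - 6 * n) / 4) * qBinom n 1 q *
    ∏ j ∈ Finset.Icc 1 (n / 2), ((q : ℚ) ^ (2 * j - 1) - 1)

/-- `A₂⁺(n,q)`, for even `n ≥ 2`; the exponent is then a natural number, so that the subtraction
and the division by 4 are exact. -/
def A₂plus (n q : ℕ) : ℚ :=
  (q : ℚ) ^ ((5 * n ^ 2 - 6 * n) / 4) * qBinom n 2 q *
    ∏ j ∈ Finset.Icc 1 ((n - 2) / 2), ((q : ℚ) ^ (2 * j - 1) - 1)

/-- `A₁⁻(n,q)`, for odd `n ≥ 1`; the exponent is then a natural number, so that the subtractions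
and the division by 4 are exact. -/
def A₁minus (n q : ℕ) : ℚ :=
  (q : ℚ) ^ ((5 * n ^ 2 - 4 * n - 1) / 4) * qBinom n 1 q *
    ∏ j ∈ Finset.Icc 1 ((n - 1) / 2), ((q : ℚ) ^ (2 * j - 1) - 1)

/-- `A₂⁻(n,q)`, for odd `n ≥ 3`; the exponent is then a natural number, so that the subtraction
and the division by 4 are exact. -/
def A₂minus (n q : ℕ) : ℚ :=
  (q : ℚ) ^ ((5 * n ^ 2 - 8 * n + 3) / 4) * qBinom n 2 q *
    ∏ j ∈ Finset.Icc 1 ((n - 1) / 2), ((q : ℚ) ^ (2 * j - 1) - 1)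

end OrthogonalExpSum

end

/-!
Write `E = diag(1_r, 0)` and `σ = [1-E E; E 1-E]`, and let `P` be the parabolic subgroup. Since the
trace is a class function, the sum of `ψ (Tr w)` over `P σ P` is `|P| / |P ∩ σ P σ|` times the sum of
`ψ (Tr (p σ))` over `p ∈ P` alone (`sum_doubleCoset_of_classFunction`).

For `p = [A AB; 0 ᵗA⁻¹]` the trace of `p σ` is `Tr (E A B) + Tr ((A + A⁻¹)(1 - E))`. Summing over the
alternating matrices `B` first leaves only those `A` for which `E A` is symmetric
(`sum_alternating_trace_mul`). These are the matrices `A = [a 0; x d]` with `a` symmetric, so that the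
sum over `A` is the number of invertible symmetric `r × r` matrices, times the number of choices of
`x`, times the Kloosterman sum over `GL(n-r,q)` (`sum_isSymm_corner`).

To find the order of `P ∩ σ P σ`, the group `P` is described as the set of all elements of the
orthogonal group with vanishing lower left block. Then `σ p σ ∈ P` becomes a condition on the lower
left block of `σ p σ`, which says that `A = [a 0; x d]` and that the upper left block of `B` vanishes
(`weyl_conj_mem_siegel_iff`).

The invertible symmetric matrices are counted by a two-step recursion, taking the Schur complement of
the corner entry or, if this entry is `0`, of an invertible block `[0 v; v x]` (`symmCount_eq`).
Finally, the Kloosterman sum over `GL(2,q)` reduces to `K(ψ;1)` because `Tr w⁻¹ = Tr w / det w` for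
`2 × 2` matrices (`kloostermanGL_two_one`). All this is collected in `traceSum_DC₁` and
`traceSum_DC₂`, after which only the exponents of `q` have to be compared.
-/

noncomputable section

namespace OrthogonalExpSum

/-! ### Alternating matrices -/

/-- The additive group of alternating matrices with rows and columns indexed by `ι`. -/
def alternating (ι F : Type*) [Field F] : AddSubgroup (Matrix ι ι F) where
  carrier := {B | (∀ i, B i i = 0) ∧ ∀ i j, B i j = -B j i}
  zero_mem' := by simp
  add_mem' := by
    rintro A B ⟨hA, hA'⟩ ⟨hB, hB'⟩
    refine ⟨fun i => by simp [hA, hB], fun i j => ?_⟩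
    rw [Matrix.add_apply, Matrix.add_apply, hA' i j, hB' i j]; ring
  neg_mem' := by
    rintro A ⟨hA, hA'⟩
    exact ⟨fun i => by simp [hA], fun i j => by rw [Matrix.neg_apply, Matrix.neg_apply, hA' i j]⟩

instance {ι F : Type*} [Field F] [Finite ι] [Finite F] : Finite (Matrix ι ι F) :=
  inferInstanceAs (Finite (ι → ι → F))

instance {ι F : Type*} [Field F] [Finite ι] [Finite F] : Fintype (alternating ι F) :=
  Fintype.ofFinite _

section

variable {ι κ F : Type*} [Field F]

theorem mem_alternating {B : Matrix ι ι F} :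
    B ∈ alternating ι F ↔ (∀ i, B i i = 0) ∧ ∀ i j, B i j = -B j i := Iff.rfl

theorem sub_transpose_mem_alternating (C : Matrix ι ι F) : C - Cᵀ ∈ alternating ι F :=
  ⟨fun i => by simp, fun i j => by simp⟩

/-- In every characteristic the alternating matrices are the matrices `C - ᵗC`: take for `C` the
strictly upper triangular part. -/
theorem exists_eq_sub_transpose [Finite ι] {B : Matrix ι ι F} (hB : B ∈ alternating ι F) :
    ∃ C : Matrix ι ι F, B = C - Cᵀ := by
  obtain ⟨n, ⟨e⟩⟩ := Finite.exists_equiv_fin ι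
  refine ⟨of fun i j => if e i < e j then B i j else 0, ?_⟩
  ext i j
  simp only [Matrix.sub_apply, of_apply, transpose_apply]
  rcases lt_trichotomy (e i) (e j) with h | h | h
  · simp [h, h.not_gt]
  · have : i = j := e.injective h
    subst this
    simp [hB.1]
  · simp [h, h.not_gt, hB.2 i j]

theorem transpose_mul_mul_mem_alternating [Fintype ι] {B : Matrix ι ι F}
    (hB : B ∈ alternating ι F) (w : Matrix ι κ F) : wᵀ * B * w ∈ alternating κ F := by
  obtain ⟨C, rfl⟩ := exists_eq_sub_transpose hB
  have : wᵀ * (C - Cᵀ) * w = wᵀ * C * w - (wᵀ * C * w)ᵀ := by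
    simp [Matrix.mul_sub, Matrix.sub_mul, Matrix.mul_assoc]
  rw [this]
  exact sub_transpose_mem_alternating _

theorem transpose_eq_neg_of_mem_alternating {B : Matrix ι ι F} (hB : B ∈ alternating ι F) :
    Bᵀ = -B := by
  ext i j
  simpa using hB.2 j i

theorem transpose_mem_alternating {B : Matrix ι ι F} (hB : B ∈ alternating ι F) :
    Bᵀ ∈ alternating ι F :=
  transpose_eq_neg_of_mem_alternating hB ▸ neg_mem hB

theorem fromBlocks_mem_alternating_iff {a : Matrix ι ι F} {b : Matrix ι κ F}
    {c : Matrix κ ι F} {d : Matrix κ κ F} : fromBlocks a b c d ∈ alternating (ι ⊕ κ) F ↔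
      a ∈ alternating ι F ∧ c = -bᵀ ∧ d ∈ alternating κ F := by
  simp only [mem_alternating, Sum.forall, fromBlocks_apply₁₁, fromBlocks_apply₁₂,
    fromBlocks_apply₂₁, fromBlocks_apply₂₂]
  constructor
  · rintro ⟨⟨h1, h2⟩, h3, h4⟩
    exact ⟨⟨h1, fun i => (h3 i).1⟩, ext fun i j => (h4 i).1 j, ⟨h2, fun i => (h4 i).2⟩⟩
  · rintro ⟨⟨h1, h2⟩, rfl, h3, h4⟩
    exact ⟨⟨h1, h3⟩, fun i => ⟨h2 i, fun j => by simp⟩, fun i => ⟨fun j => by simp, h4 i⟩⟩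

theorem fromBlocks_sub {l m n o : Type*} (A A' : Matrix n l F) (B B' : Matrix n m F)
    (C C' : Matrix o l F) (D D' : Matrix o m F) : fromBlocks A B C D - fromBlocks A' B' C' D' =
      fromBlocks (A - A') (B - B') (C - C') (D - D') := by
  ext (i | i) (j | j) <;> rfl

theorem trace_mul_sub_transpose [Fintype ι] (M C : Matrix ι ι F) :
    (M * (C - Cᵀ)).trace = ((M - Mᵀ) * C).trace := by
  rw [Matrix.mul_sub, Matrix.sub_mul, trace_sub, trace_sub, ← trace_transpose (M * Cᵀ),
    transpose_mul, transpose_transpose, trace_mul_comm C]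

/-- Orthogonality: the linear form `B ↦ Tr (M B)` vanishes on the alternating matrices exactly when
`M` is symmetric. -/
theorem sum_alternating_trace_mul [Fintype ι] [DecidableEq ι] [Fintype F] [DecidableEq F]
    {ψ : AddChar F ℂ} (hψ : ψ ≠ 1) (M : Matrix ι ι F) :
    ∑ B : alternating ι F, ψ (M * (B : Matrix ι ι F)).trace =
      if M.IsSymm then (Fintype.card (alternating ι F) : ℂ) else 0 := by
  let χ : AddChar (alternating ι F) ℂ :=
    ψ.compAddMonoidHom ⟨⟨fun B => (M * (B : Matrix ι ι F)).trace, by simp⟩,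
      fun A B => by simp [Matrix.mul_add]⟩
  have hχ : ∀ B, χ B = ψ (M * (B : Matrix ι ι F)).trace := fun B => rfl
  have key : χ = 0 ↔ M.IsSymm := by
    constructor
    · intro h
      by_contra hM
      obtain ⟨i, j, hij⟩ : ∃ i j, (M - Mᵀ) i j ≠ 0 := by
        by_contra! h0
        exact hM (sub_eq_zero.1 (ext h0)).symm
      refine hψ (DFunLike.ext _ _ fun x => ?_)
      have h1 := hχ ⟨_, sub_transpose_mem_alternating (single j i (((M - Mᵀ) i j)⁻¹ * x))⟩
      rw [h, trace_mul_sub_transpose, trace_mul_single, op_smul_eq_mul,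
        mul_inv_cancel_left₀ hij] at h1
      simpa using h1.symm
    · intro h
      ext ⟨B, hB⟩
      obtain ⟨C, rfl⟩ := exists_eq_sub_transpose hB
      rw [hχ, trace_mul_sub_transpose, h.eq, sub_self]
      simp
  simp_rw [← hχ]
  rw [AddChar.sum_eq_ite]
  simp only [key]

end

/-! ### Sums of class functions over double cosets -/

section

open scoped Classical in
/-- Every element of the double coset `H g H` is `x g y` for exactly `|H ∩ g H g⁻¹|` pairs
`(x, y)` in `H × H`. A class function sees `x g y` only through `y x g`, which makes one of the two
sums trivial. -/
theorem sum_doubleCoset_of_classFunction {G : Type*} [Group G] [Fintype G] (H : Subgroup G) (g : G)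
    (f : G → ℂ) (hf : ∀ x y, f (x * y) = f (y * x)) :
    (Nat.card {k : H // g⁻¹ * k * g ∈ H} : ℂ) *
        ∑ w ∈ (DoubleCoset.doubleCoset g (H : Set G) H).toFinite.toFinset, f w =
      Nat.card H * ∑ p : H, f (p * g) := by
  have h1 : ∑ x : H × H, f (x.1 * g * x.2) = Nat.card H * ∑ p : H, f (p * g) := by
    rw [Fintype.sum_prod_type_right, Nat.card_eq_fintype_card, ← nsmul_eq_mul, ← Finset.card_univ,
      ← Finset.sum_const]
    refine Finset.sum_congr rfl fun y _ => ?_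
    refine Fintype.sum_equiv (Equiv.mulLeft y) _ _ fun x => ?_
    rw [hf]
    simp [mul_assoc]
  rw [← h1, Finset.mul_sum, ← Finset.sum_fiberwise_of_maps_to (s := Finset.univ)
    (t := (DoubleCoset.doubleCoset g (H : Set G) H).toFinite.toFinset)
    (g := fun x : H × H => (x.1 * g * x.2 : G))]
  · refine Finset.sum_congr rfl fun w hw => ?_
    rw [Finset.sum_congr rfl (g := fun _ => f w)
      (fun x hx => by rw [(Finset.mem_filter.1 hx).2]), Finset.sum_const, nsmul_eq_mul]
    congr 2
    rw [Set.Finite.mem_toFinset, DoubleCoset.mem_doubleCoset] at hw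
    obtain ⟨a, ha, b, hb, rfl⟩ := hw
    rw [← Fintype.card_subtype, ← Nat.card_eq_fintype_card]
    -- the pair attached to `k` is `(a k, (g⁻¹ k g)⁻¹ b)`
    refine Nat.card_congr ⟨fun k => ⟨(⟨a, ha⟩ * k.1, ⟨_, k.2⟩⁻¹ * ⟨b, hb⟩), by simp [mul_assoc]⟩,
      fun x => ⟨⟨a, ha⟩⁻¹ * x.1.1, ?_⟩, fun k => by ext; simp, fun x => ?_⟩
    · have hx : (x.1.1 * g * x.1.2 : G) = a * g * b := x.2
      have : g⁻¹ * ((⟨a, ha⟩⁻¹ * x.1.1 : H) : G) * g = b * (x.1.2 : G)⁻¹ := by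
        rw [eq_mul_inv_iff_mul_eq]
        simp only [Subgroup.coe_mul, Subgroup.coe_inv]
        rw [show g⁻¹ * (a⁻¹ * (x.1.1 : G)) * g * x.1.2 = g⁻¹ * a⁻¹ * (x.1.1 * g * x.1.2) by group, hx]
        group
      rw [this]
      exact H.mul_mem hb (H.inv_mem x.1.2.2)
    · have hx : (x.1.1 * g * x.1.2 : G) = a * g * b := x.2
      refine Subtype.ext (Prod.ext (by simp) (Subtype.ext ?_))
      simp only [Subgroup.coe_mul, Subgroup.coe_inv]
      rw [inv_mul_eq_iff_eq_mul, show g⁻¹ * (a⁻¹ * (x.1.1 : G)) * g * x.1.2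
        = g⁻¹ * a⁻¹ * (x.1.1 * g * x.1.2) by group, hx]
      group
  · intro x _
    rw [Set.Finite.mem_toFinset, DoubleCoset.mem_doubleCoset]
    exact ⟨x.1, x.1.2, x.2, x.2.2, rfl⟩

end

/-! ### The orthogonal group and its parabolic subgroup -/

section

variable {ι F : Type*} [Field F] [Fintype ι] [DecidableEq ι]

/-- The group of all `w` that preserve the quadratic form `(x, y) ↦ ᵗx y` on `F^ι × F^ι`. With
`J` the matrix `[0 1; 0 0]` of this form, this says that `ᵗw J w - J` is alternating. -/
def orthogonal (ι F : Type*) [Field F] [Fintype ι] [DecidableEq ι] : Subgroup (GL (ι ⊕ ι) F) where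
  carrier := {w | w.valᵀ * fromBlocks 0 1 0 0 * w.val - fromBlocks 0 1 0 0 ∈ alternating (ι ⊕ ι) F}
  one_mem' := by simp
  mul_mem' := by
    intro v w hv hw
    have := add_mem (transpose_mul_mul_mem_alternating hv w.val) hw
    simp only [Set.mem_ofPred_eq, Units.val_mul, transpose_mul]
    convert this using 1
    noncomm_ring
  inv_mem' := by
    intro w hw
    have := neg_mem (transpose_mul_mul_mem_alternating hw
      (w⁻¹).val)
    have h1 : w.val * (w⁻¹).val = 1 := w.mul_inv
    have h2 := congrArg transpose h1
    rw [transpose_mul, transpose_one] at h2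
    simp only [Set.mem_ofPred_eq]
    convert this using 1
    have h3 : (w⁻¹).valᵀ * (w.valᵀ * fromBlocks 0 1 0 0 * w.val) * (w⁻¹).val =
        ((w⁻¹).valᵀ * w.valᵀ) * fromBlocks 0 1 0 0 * (w.val * (w⁻¹).val) := by
      simp only [Matrix.mul_assoc]
    rw [Matrix.mul_sub, Matrix.sub_mul, neg_sub, h3, h1, h2, Matrix.one_mul, Matrix.mul_one]

theorem mem_orthogonal {w : GL (ι ⊕ ι) F} : w ∈ orthogonal ι F ↔
    w.valᵀ * fromBlocks 0 1 0 0 * w.val - fromBlocks 0 1 0 0 ∈ alternating (ι ⊕ ι) F := Iff.rfl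

/-- The invertible matrix `[A 0; 0 ᵗA⁻¹] [1 B; 0 1] = [A AB; 0 ᵗA⁻¹]`. -/
def parabolicElement (A : GL ι F) (B : Matrix ι ι F) : GL (ι ⊕ ι) F where
  val := fromBlocks A (A * B) 0 (A⁻¹).valᵀ
  inv := fromBlocks (A⁻¹).val (-(B * A.valᵀ)) 0 A.valᵀ
  val_inv := by
    have h1 : A.val * (A⁻¹).val = 1 := A.mul_inv
    have h2 := congrArg transpose h1
    rw [transpose_mul, transpose_one] at h2
    simp [fromBlocks_multiply, h1, h2, Matrix.mul_assoc, -coe_units_inv]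
  inv_val := by
    have h1 : (A⁻¹).val * A = 1 := A.inv_mul
    have h2 := congrArg transpose h1
    rw [transpose_mul, transpose_one] at h2
    simp [fromBlocks_multiply, h1, h2, Matrix.mul_assoc, ← Matrix.mul_assoc (A⁻¹).val,
      -coe_units_inv]

/-- The Siegel parabolic subgroup: the elements of the orthogonal group whose lower left block
vanishes. -/
def siegel (ι F : Type*) [Field F] [Fintype ι] [DecidableEq ι] : Subgroup (GL (ι ⊕ ι) F) where
  carrier := {w | w ∈ orthogonal ι F ∧ w.val.toBlocks₂₁ = 0}
  one_mem' := ⟨one_mem _, by ext; simp [toBlocks₂₁]⟩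
  mul_mem' := by
    rintro v w ⟨hv, hv'⟩ ⟨hw, hw'⟩
    refine ⟨mul_mem hv hw, ?_⟩
    rw [Units.val_mul, ← fromBlocks_toBlocks v.val,
      ← fromBlocks_toBlocks w.val, fromBlocks_multiply, hv', hw']
    simp
  inv_mem' := by
    rintro w ⟨hw, hw'⟩
    refine ⟨inv_mem hw, ?_⟩
    have h : w.val * (w⁻¹).val = 1 := w.mul_inv
    rw [← fromBlocks_toBlocks w.val,
      ← fromBlocks_toBlocks (w⁻¹).val, fromBlocks_multiply,
      ← fromBlocks_one, fromBlocks_inj, hw'] at h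
    simp only [Matrix.zero_mul, zero_add] at h
    obtain ⟨-, -, h1, h2⟩ := h
    have h3 := mul_eq_one_comm.1 h2
    rw [← Matrix.one_mul (toBlocks₂₁ _), ← h3, Matrix.mul_assoc, h1, Matrix.mul_zero]

theorem mem_siegel {w : GL (ι ⊕ ι) F} : w ∈ siegel ι F ↔
    w ∈ orthogonal ι F ∧ w.val.toBlocks₂₁ = 0 := Iff.rfl

theorem mem_siegel_iff_exists {w : GL (ι ⊕ ι) F} :
    w ∈ siegel ι F ↔ ∃ A : GL ι F, ∃ B ∈ alternating ι F, w = parabolicElement A B := by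
  rw [mem_siegel, mem_orthogonal]
  constructor
  · rintro ⟨h, h0⟩
    obtain ⟨a, b, c, d, hw⟩ : ∃ a b c d, w.val = fromBlocks a b c d :=
      ⟨_, _, _, _, (fromBlocks_toBlocks _).symm⟩
    rw [hw, toBlocks_fromBlocks₂₁] at h0
    subst h0
    simp only [hw, fromBlocks_transpose, fromBlocks_multiply, fromBlocks_sub,
      fromBlocks_mem_alternating_iff] at h
    simp only [transpose_zero, Matrix.zero_mul, Matrix.mul_zero, add_zero, Matrix.mul_one, sub_zero,
      zero_add] at h
    obtain ⟨-, h1, h2⟩ := h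
    have h3 : aᵀ * d = 1 := by
      have := congrArg transpose h1
      simp only [transpose_zero, transpose_neg, transpose_transpose] at this
      exact sub_eq_zero.1 (neg_eq_zero.1 this.symm)
    have h4 : dᵀ * a = 1 := by simpa using congrArg transpose h3
    refine ⟨⟨a, dᵀ, mul_eq_one_comm.1 h4, h4⟩, dᵀ * b, ?_, ?_⟩
    · simpa using transpose_mem_alternating h2
    · ext1
      rw [hw]
      simp [parabolicElement, ← Matrix.mul_assoc, mul_eq_one_comm.1 h4]
  · rintro ⟨A, B, hB, rfl⟩
    have h1 : (A⁻¹).val * A = 1 := A.inv_mul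
    have h2 := congrArg transpose h1
    rw [transpose_mul, transpose_one] at h2
    refine ⟨?_, by simp [parabolicElement]⟩
    simp [parabolicElement, fromBlocks_transpose, fromBlocks_multiply, fromBlocks_sub,
      fromBlocks_mem_alternating_iff, h2, -coe_units_inv, Matrix.mul_assoc, zero_mem,
      transpose_mem_alternating hB]

theorem parabolicElement_inj {A A' : GL ι F} {B B' : Matrix ι ι F} :
    parabolicElement A B = parabolicElement A' B' ↔ A = A' ∧ B = B' := by
  refine ⟨fun h => ?_, fun h => by rw [h.1, h.2]⟩
  have h1 := congrArg (fun w : GL (ι ⊕ ι) F => w.val) h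
  simp only [parabolicElement, fromBlocks_inj] at h1
  have hA : A = A' := Units.ext h1.1
  subst hA
  refine ⟨rfl, ?_⟩
  have h2 := congrArg ((A⁻¹).val * ·) h1.2.1
  simpa [← Matrix.mul_assoc] using h2

/-- The parabolic subgroup is parametrized by the pairs `(A, B)`. -/
def siegelEquiv (ι F : Type*) [Field F] [Fintype ι] [DecidableEq ι] :
    GL ι F × alternating ι F ≃ siegel ι F :=
  Equiv.ofBijective (fun x => ⟨parabolicElement x.1 x.2, mem_siegel_iff_exists.2
    ⟨x.1, x.2, x.2.2, rfl⟩⟩) ⟨fun x y h => by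
      have := parabolicElement_inj.1 (Subtype.ext_iff.1 h)
      exact Prod.ext this.1 (Subtype.ext this.2), fun w => by
      obtain ⟨A, B, hB, h⟩ := mem_siegel_iff_exists.1 w.2
      exact ⟨(A, ⟨B, hB⟩), Subtype.ext h.symm⟩⟩

theorem coe_siegelEquiv (x : GL ι F × alternating ι F) :
    (siegelEquiv ι F x : GL (ι ⊕ ι) F) = parabolicElement x.1 x.2 := rfl

theorem card_siegel [Finite F] :
    Nat.card (siegel ι F) = Nat.card (GL ι F) * Nat.card (alternating ι F) := by
  rw [← Nat.card_congr (siegelEquiv ι F), Nat.card_prod]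

end

/-! ### Reduction to sums over the general linear group -/

section

variable {ι F : Type*} [Field F] [Fintype ι] [DecidableEq ι]

/-- For a symmetric idempotent `E`, the involution `[1-E E; E 1-E]`, which interchanges the two
copies of the range of `E`. For diagonal `E` this is one of the matrices `σ_r⁺`. -/
def weyl (E : Matrix ι ι F) (hE : E * E = E) : GL (ι ⊕ ι) F where
  val := fromBlocks (1 - E) E E (1 - E)
  inv := fromBlocks (1 - E) E E (1 - E)
  val_inv := by simp [fromBlocks_multiply, Matrix.mul_sub, Matrix.sub_mul, hE]
  inv_val := by simp [fromBlocks_multiply, Matrix.mul_sub, Matrix.sub_mul, hE]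

theorem weyl_mem_orthogonal {E : Matrix ι ι F} (hE : E * E = E) (hs : E.IsSymm) :
    weyl E hE ∈ orthogonal ι F := by
  rw [mem_orthogonal]
  simp [weyl, fromBlocks_transpose, fromBlocks_multiply, fromBlocks_sub, hs.eq, hE,
    fromBlocks_mem_alternating_iff, Matrix.mul_sub, Matrix.sub_mul, zero_mem]

/-- The lower left block of the conjugate is `E A (1-E) + E A B E + (1-E) ᵗA⁻¹ E`, and its three
summands live in different corners with respect to `E`. -/
theorem weyl_conj_mem_siegel_iff {E : Matrix ι ι F} (hE : E * E = E) (hs : E.IsSymm)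
    (A : GL ι F) {B : Matrix ι ι F} (hB : B ∈ alternating ι F) :
    (weyl E hE)⁻¹ * parabolicElement A B * weyl E hE ∈ siegel ι F ↔
      (E * A.val * (1 - E) = 0 ∧ E * (A⁻¹).val * (1 - E) = 0) ∧ E * B * E = 0 := by
  have hw := weyl_mem_orthogonal hE hs
  have hp : parabolicElement A B ∈ orthogonal ι F :=
    (mem_siegel_iff_exists.2 ⟨A, B, hB, rfl⟩).1
  have hblock : ((weyl E hE)⁻¹ * parabolicElement A B * weyl E hE).val.toBlocks₂₁ =
      E * A.val * (1 - E) + (E * A.val * B * E + (1 - E) * (A⁻¹).valᵀ * E) := by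
    have h1 : ((weyl E hE)⁻¹).val = fromBlocks (1 - E) E E (1 - E) := rfl
    rw [Units.val_mul, Units.val_mul, h1]
    simp [weyl, parabolicElement, fromBlocks_multiply, -coe_units_inv, Matrix.add_mul,
      Matrix.mul_assoc]
  rw [mem_siegel, hblock, and_iff_right (mul_mem (mul_mem (inv_mem hw) hp) hw)]
  have hE1 : E * (1 - E) = 0 := by rw [Matrix.mul_sub, hE, Matrix.mul_one, sub_self]
  have hE2 : (1 - E) * E = 0 := by rw [Matrix.sub_mul, hE, Matrix.one_mul, sub_self]
  have hE3 : (1 - E) * (1 - E) = 1 - E := by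
    rw [Matrix.mul_sub, Matrix.mul_one, hE2, sub_zero]
  have hT : (E * (A⁻¹).val * (1 - E))ᵀ = (1 - E) * (A⁻¹).valᵀ * E := by
    simp [hs.eq, Matrix.mul_assoc]
  rw [← transpose_eq_zero (M := E * (A⁻¹).val * (1 - E)), hT]
  have hinv : (A⁻¹).val * A.val = 1 := A.inv_mul
  constructor
  · intro h
    have hX : E * A.val * (1 - E) = 0 := by
      have := congrArg (fun M => M * (1 - E)) h
      simpa only [Matrix.add_mul, Matrix.mul_assoc, hE1, hE3, Matrix.mul_zero, add_zero,
        Matrix.zero_mul] using this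
    have hZ : (1 - E) * (A⁻¹).valᵀ * E = 0 := by
      have := congrArg (fun M => (1 - E) * M) h
      simpa only [Matrix.mul_add, ← Matrix.mul_assoc, hE2, hE3, Matrix.mul_zero, zero_add,
        Matrix.zero_mul] using this
    have hY : E * A.val * B * E = 0 := by simpa only [hX, hZ, zero_add, add_zero] using h
    refine ⟨⟨hX, hZ⟩, ?_⟩
    have hZ' : E * (A⁻¹).val * (1 - E) = 0 := by rw [← transpose_eq_zero, hT, hZ]
    rw [Matrix.mul_sub, Matrix.mul_one, sub_eq_zero] at hZ'
    calc E * B * E = E * ((A⁻¹).val * A.val) * B * E := by rw [hinv, Matrix.mul_one]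
      _ = E * (A⁻¹).val * (A.val * B * E) := by simp only [Matrix.mul_assoc]
      _ = E * (A⁻¹).val * (E * A.val * B * E) := by
        rw [hZ']
        simp only [← Matrix.mul_assoc]
        simp only [Matrix.mul_assoc _ E E, hE]
      _ = 0 := by rw [hY, Matrix.mul_zero]
  · rintro ⟨⟨hX, hZ⟩, hY⟩
    have hX' := hX
    rw [Matrix.mul_sub, Matrix.mul_one, sub_eq_zero] at hX'
    rw [hX, hZ, hX', Matrix.mul_assoc, Matrix.mul_assoc, ← Matrix.mul_assoc E B, hY]
    simp

theorem trace_fromBlocks {k l F : Type*} [Field F] [Fintype k] [Fintype l] (a : Matrix k k F)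
    (b : Matrix k l F) (c : Matrix l k F) (d : Matrix l l F) :
    (fromBlocks a b c d).trace = a.trace + d.trace := by
  simp [trace]

theorem trace_parabolicElement_mul_weyl {E : Matrix ι ι F} (hE : E * E = E) (hs : E.IsSymm)
    (A : GL ι F) (B : Matrix ι ι F) : (parabolicElement A B * weyl E hE).val.trace =
      (E * A.val * B).trace + (A.val * (1 - E) + (A⁻¹).val * (1 - E)).trace := by
  have h1 : (A.val * B * E).trace = (E * A.val * B).trace := by
    rw [trace_mul_comm, Matrix.mul_assoc]
  have h2 : ((A⁻¹).valᵀ * (1 - E)).trace = ((A⁻¹).val * (1 - E)).trace := by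
    rw [← trace_transpose, transpose_mul, transpose_transpose, trace_mul_comm]
    simp [hs.eq]
  rw [Units.val_mul]
  simp only [parabolicElement, weyl, fromBlocks_multiply, trace_fromBlocks, trace_add, h1,
    Matrix.zero_mul, zero_add, h2]
  ring

/-- The double coset sum in terms of a sum over the general linear group: the sum over `B` in
`P = {(A, B)}` of `ψ (Tr (p σ))` vanishes unless `E A` is symmetric. -/
theorem sum_doubleCoset_weyl [Fintype F] [DecidableEq F] {ψ : AddChar F ℂ} (hψ : ψ ≠ 1)
    {E : Matrix ι ι F} (hE : E * E = E) (hs : E.IsSymm) :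
    (Nat.card {A : GL ι F // E * A.val * (1 - E) = 0 ∧ E * (A⁻¹).val * (1 - E) = 0} : ℂ) *
      Nat.card {B : alternating ι F // E * B.val * E = 0} *
      ∑ w ∈ (DoubleCoset.doubleCoset (weyl E hE) (siegel ι F : Set (GL (ι ⊕ ι) F))
        (siegel ι F)).toFinite.toFinset, ψ w.val.trace =
    Nat.card (GL ι F) * Nat.card (alternating ι F) ^ 2 *
      ∑ A : GL ι F, if (E * A.val).IsSymm then
        ψ (A.val * (1 - E) + (A⁻¹).val * (1 - E)).trace else 0 := by
  classical
  have hcard : Nat.card {k : siegel ι F // (weyl E hE)⁻¹ * k * weyl E hE ∈ siegel ι F} =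
      Nat.card {A : GL ι F // E * A.val * (1 - E) = 0 ∧ E * (A⁻¹).val * (1 - E) = 0} *
        Nat.card {B : alternating ι F // E * B.val * E = 0} := by
    rw [← Nat.card_prod]
    refine Nat.card_congr (((siegelEquiv ι F).subtypeEquiv fun x => ?_).symm.trans
      (Equiv.subtypeProdEquivProd (p := fun A : GL ι F => E * A.val * (1 - E) = 0 ∧
        E * (A⁻¹).val * (1 - E) = 0) (q := fun B : alternating ι F => E * B.val * E = 0)))
    exact (weyl_conj_mem_siegel_iff hE hs x.1 x.2.2).symm
  have hmain := sum_doubleCoset_of_classFunction (siegel ι F) (weyl E hE)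
    (fun w => ψ w.val.trace) (fun x y => by
      rw [Units.val_mul, Units.val_mul, trace_mul_comm])
  rw [hcard, Nat.cast_mul] at hmain
  rw [hmain, card_siegel, Nat.cast_mul, sq, mul_assoc, mul_assoc, mul_assoc, ← mul_assoc]
  rw [mul_assoc, ← (siegelEquiv ι F).sum_comp, Fintype.sum_prod_type]
  congr 2
  rw [Finset.mul_sum]
  refine Finset.sum_congr rfl fun A _ => ?_
  simp only [coe_siegelEquiv, trace_parabolicElement_mul_weyl hE hs, AddChar.map_add_eq_mul]
  rw [← Finset.sum_mul, sum_alternating_trace_mul hψ, Nat.card_eq_fintype_card]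
  split_ifs <;> simp

end

section

variable {ι κ F : Type*} [Field F] [Fintype ι] [DecidableEq ι] [Fintype κ] [DecidableEq κ]

/-- Renaming the rows and columns, as an isomorphism of general linear groups. -/
def reindexGL (F : Type*) [Field F] (e : ι ≃ κ) : GL ι F ≃* GL κ F :=
  Units.mapEquiv (reindexAlgEquiv F F e).toMulEquiv

theorem val_reindexGL (e : ι ≃ κ) (A : GL ι F) :
    (reindexGL F e A).val = reindexAlgEquiv F F e A.val := rfl

theorem val_inv_reindexGL (e : ι ≃ κ) (A : GL ι F) :
    ((reindexGL F e A)⁻¹).val = reindexAlgEquiv F F e (A⁻¹).val := rfl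

theorem trace_reindexAlgEquiv (e : ι ≃ κ) (M : Matrix ι ι F) :
    (reindexAlgEquiv F F e M).trace = M.trace := by
  simp only [coe_reindexAlgEquiv, trace, diag_apply, reindex_apply, submatrix_apply]
  exact e.symm.sum_comp fun i => M i i

theorem isSymm_reindexAlgEquiv_iff (e : ι ≃ κ) (M : Matrix ι ι F) :
    (reindexAlgEquiv F F e M).IsSymm ↔ M.IsSymm := by
  rw [IsSymm, IsSymm, ← (reindexAlgEquiv F F e).injective.eq_iff (a := Mᵀ)]
  simp [coe_reindexAlgEquiv]

theorem card_corner_reindex (e : ι ≃ κ) (E : Matrix ι ι F) :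
    Nat.card {A : GL κ F // reindexAlgEquiv F F e E * A.val * (1 - reindexAlgEquiv F F e E) = 0 ∧
      reindexAlgEquiv F F e E * (A⁻¹).val * (1 - reindexAlgEquiv F F e E) = 0} =
    Nat.card {A : GL ι F // E * A.val * (1 - E) = 0 ∧ E * (A⁻¹).val * (1 - E) = 0} := by
  refine Nat.card_congr ((reindexGL F e).toEquiv.subtypeEquiv fun A => ?_).symm
  change _ ↔ _ * (reindexGL F e A).val * _ = 0 ∧ _ * ((reindexGL F e A)⁻¹).val * _ = 0
  rw [val_reindexGL, val_inv_reindexGL, ← map_one (reindexAlgEquiv F F e), ← map_sub, ← map_mul,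
    ← map_mul, ← map_mul, ← map_mul, map_eq_zero_iff _ (reindexAlgEquiv F F e).injective,
    map_eq_zero_iff _ (reindexAlgEquiv F F e).injective]

theorem reindexAlgEquiv_mem_alternating_iff (e : ι ≃ κ) (B : Matrix ι ι F) :
    reindexAlgEquiv F F e B ∈ alternating κ F ↔ B ∈ alternating ι F := by
  simp [mem_alternating, coe_reindexAlgEquiv, e.symm.forall_congr_left]

theorem card_alternating_reindex (e : ι ≃ κ) :
    Nat.card (alternating κ F) = Nat.card (alternating ι F) :=
  Nat.card_congr ((reindexAlgEquiv F F e).toEquiv.subtypeEquiv fun B =>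
    (reindexAlgEquiv_mem_alternating_iff e B).symm).symm

theorem card_alternating_corner_reindex (e : ι ≃ κ) (E : Matrix ι ι F) :
    Nat.card {B : alternating κ F //
      reindexAlgEquiv F F e E * B.val * reindexAlgEquiv F F e E = 0} =
    Nat.card {B : alternating ι F // E * B.val * E = 0} := by
  refine Nat.card_congr (((reindexAlgEquiv F F e).toEquiv.subtypeEquiv fun B =>
    (reindexAlgEquiv_mem_alternating_iff e B).symm).subtypeEquiv fun B => ?_).symm
  change _ ↔ _ * reindexAlgEquiv F F e B.val * _ = 0
  rw [← map_mul, ← map_mul, map_eq_zero_iff _ (reindexAlgEquiv F F e).injective]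

theorem sum_isSymm_reindex [Fintype F] [DecidableEq F] (ψ : AddChar F ℂ) (e : ι ≃ κ)
    (E : Matrix ι ι F) :
    (∑ A : GL κ F, if (reindexAlgEquiv F F e E * A.val).IsSymm then
      ψ (A.val * (1 - reindexAlgEquiv F F e E) +
        (A⁻¹).val * (1 - reindexAlgEquiv F F e E)).trace else 0) =
    ∑ A : GL ι F, if (E * A.val).IsSymm then
      ψ (A.val * (1 - E) + (A⁻¹).val * (1 - E)).trace else 0 := by
  refine (Fintype.sum_equiv (reindexGL F e).toEquiv _ _ fun A => ?_).symm
  change _ = if (_ * (reindexGL F e A).val).IsSymm then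
    ψ ((reindexGL F e A).val * _ + ((reindexGL F e A)⁻¹).val * _).trace else 0
  rw [val_reindexGL, val_inv_reindexGL, ← map_one (reindexAlgEquiv F F e), ← map_sub, ← map_mul,
    ← map_mul, ← map_mul, ← map_add, trace_reindexAlgEquiv]
  simp only [isSymm_reindexAlgEquiv_iff]

end

/-! ### Block decompositions -/

section

variable {k l F : Type*} [Field F]

/-- An alternating matrix in blocks. -/
def alternatingSumEquiv (k l F : Type*) [Field F] :
    alternating (k ⊕ l) F ≃ alternating k F × Matrix k l F × alternating l F where
  toFun B := (⟨B.1.toBlocks₁₁, by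
      have h := B.2
      rw [← fromBlocks_toBlocks B.1, fromBlocks_mem_alternating_iff] at h
      exact h.1⟩, B.1.toBlocks₁₂, ⟨B.1.toBlocks₂₂, by
      have h := B.2
      rw [← fromBlocks_toBlocks B.1, fromBlocks_mem_alternating_iff] at h
      exact h.2.2⟩)
  invFun x := ⟨fromBlocks x.1 x.2.1 (-x.2.1ᵀ) x.2.2,
    fromBlocks_mem_alternating_iff.2 ⟨x.1.2, rfl, x.2.2.2⟩⟩
  left_inv B := by
    have h := B.2
    rw [← fromBlocks_toBlocks B.1, fromBlocks_mem_alternating_iff] at h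
    ext1
    simp only
    rw [← h.2.1, fromBlocks_toBlocks]
  right_inv x := by simp

theorem card_matrix {k l F : Type*} [Finite k] [Finite l] [Fintype F] :
    Nat.card (Matrix k l F) = Fintype.card F ^ (Nat.card k * Nat.card l) := by
  rw [Matrix, Nat.card_fun, Nat.card_fun, Nat.card_eq_fintype_card (α := F), ← pow_mul, mul_comm]

variable [Fintype k] [Fintype l] [DecidableEq k] [DecidableEq l]

theorem card_alternating_sum {k l F : Type*} [Field F] [Fintype k] [Fintype l] [Fintype F] :
    Nat.card (alternating (k ⊕ l) F) =
    Nat.card (alternating k F) * Fintype.card F ^ (Fintype.card k * Fintype.card l) *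
      Nat.card (alternating l F) := by
  rw [Nat.card_congr (alternatingSumEquiv k l F), Nat.card_prod, Nat.card_prod, card_matrix,
    mul_assoc, Nat.card_eq_fintype_card (α := k), Nat.card_eq_fintype_card (α := l)]

theorem card_alternating_corner [Fintype F] :
    Nat.card {B : alternating (k ⊕ l) F // (fromBlocks 1 0 0 0 : Matrix (k ⊕ l) (k ⊕ l) F) *
      B.val * (fromBlocks 1 0 0 0 : Matrix (k ⊕ l) (k ⊕ l) F) = 0} =
    Fintype.card F ^ (Fintype.card k * Fintype.card l) * Nat.card (alternating l F) := by
  have : Nat.card {x : alternating k F × Matrix k l F × alternating l F // x.1 = 0} =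
      Nat.card (Matrix k l F × alternating l F) :=
    Nat.card_congr ⟨fun x => x.1.2, fun y => ⟨(0, y), rfl⟩,
      fun x => Subtype.ext (Prod.ext x.2.symm rfl), fun y => rfl⟩
  rw [← Nat.card_eq_fintype_card (α := k), ← Nat.card_eq_fintype_card (α := l), ← card_matrix,
    ← Nat.card_prod, ← this]
  refine Nat.card_congr ((alternatingSumEquiv k l F).subtypeEquiv fun B => ?_)
  rw [← fromBlocks_toBlocks B.val, fromBlocks_multiply, fromBlocks_multiply, ← fromBlocks_zero,
    fromBlocks_inj]
  simp [alternatingSumEquiv, Subtype.ext_iff]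

/-- The invertible block lower triangular matrix `[a 0; x d]`. -/
def blockLower (a : GL k F) (d : GL l F) (x : Matrix l k F) : GL (k ⊕ l) F where
  val := fromBlocks a 0 x d
  inv := fromBlocks (a⁻¹).val 0 (-((d⁻¹).val * x * (a⁻¹).val)) (d⁻¹).val
  val_inv := by
    have ha : a.val * (a⁻¹).val = 1 := a.mul_inv
    have hd : d.val * (d⁻¹).val = 1 := d.mul_inv
    simp [fromBlocks_multiply, ha, hd, ← Matrix.mul_assoc, -coe_units_inv]
  inv_val := by
    have ha : (a⁻¹).val * a.val = 1 := a.inv_mul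
    have hd : (d⁻¹).val * d.val = 1 := d.inv_mul
    simp [fromBlocks_multiply, ha, hd, Matrix.mul_assoc, -coe_units_inv]

theorem val_blockLower (a : GL k F) (d : GL l F) (x : Matrix l k F) :
    (blockLower a d x).val = fromBlocks a.val 0 x d.val := rfl

theorem val_inv_blockLower (a : GL k F) (d : GL l F) (x : Matrix l k F) :
    ((blockLower a d x)⁻¹).val =
      fromBlocks (a⁻¹).val 0 (-((d⁻¹).val * x * (a⁻¹).val)) (d⁻¹).val := rfl

theorem exists_eq_blockLower {A : GL (k ⊕ l) F} (hA : A.val.toBlocks₁₂ = 0) :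
    ∃ a d x, A = blockLower a d x := by
  have h : A.val * (A⁻¹).val = 1 := A.mul_inv
  rw [← fromBlocks_toBlocks A.val, ← fromBlocks_toBlocks (A⁻¹).val, fromBlocks_multiply,
    ← fromBlocks_one, fromBlocks_inj, hA] at h
  simp only [Matrix.zero_mul, add_zero] at h
  obtain ⟨h1, h2, -, h4⟩ := h
  have h1' := mul_eq_one_comm.1 h1
  have h5 : (A⁻¹).val.toBlocks₁₂ = 0 := by
    rw [← Matrix.one_mul (toBlocks₁₂ _), ← h1', Matrix.mul_assoc, h2, Matrix.mul_zero]
  rw [h5, Matrix.mul_zero, zero_add] at h4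
  refine ⟨⟨_, _, h1, h1'⟩, ⟨_, _, h4, mul_eq_one_comm.1 h4⟩, A.val.toBlocks₂₁, ?_⟩
  ext1
  rw [val_blockLower, ← hA, fromBlocks_toBlocks]

/-- The invertible matrices with vanishing upper right block are the matrices `[a 0; x d]` with
`a` and `d` invertible. -/
def blockLowerEquiv (k l F : Type*) [Field F] [Fintype k] [Fintype l] [DecidableEq k]
    [DecidableEq l] :
    GL k F × GL l F × Matrix l k F ≃ {A : GL (k ⊕ l) F // A.val.toBlocks₁₂ = 0} :=
  Equiv.ofBijective (fun y => ⟨blockLower y.1 y.2.1 y.2.2, by simp [val_blockLower]⟩)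
    ⟨fun y z h => by
      have h1 := congrArg Units.val (Subtype.ext_iff.1 h)
      simp only [val_blockLower, fromBlocks_inj] at h1
      exact Prod.ext (Units.ext h1.1) (Prod.ext (Units.ext h1.2.2.2) h1.2.2.1),
    fun A => by
      obtain ⟨a, d, x, h⟩ := exists_eq_blockLower A.2
      exact ⟨(a, d, x), Subtype.ext h.symm⟩⟩

theorem coe_blockLowerEquiv (y : GL k F × GL l F × Matrix l k F) :
    (blockLowerEquiv k l F y).val = blockLower y.1 y.2.1 y.2.2 := rfl

theorem one_sub_corner {k l F : Type*} [Field F] [DecidableEq k] [DecidableEq l] :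
    (1 : Matrix (k ⊕ l) (k ⊕ l) F) - fromBlocks 1 0 0 0 = fromBlocks 0 0 0 1 := by
  rw [← fromBlocks_one, fromBlocks_sub]; simp

theorem card_corner [Fintype F] :
    Nat.card {A : GL (k ⊕ l) F // (fromBlocks 1 0 0 0 : Matrix (k ⊕ l) (k ⊕ l) F) * A.val *
        (1 - fromBlocks 1 0 0 0) = 0 ∧ (fromBlocks 1 0 0 0 : Matrix (k ⊕ l) (k ⊕ l) F) *
        (A⁻¹).val * (1 - fromBlocks 1 0 0 0) = 0} =
      Nat.card (GL k F) * Nat.card (GL l F) *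
        Fintype.card F ^ (Fintype.card k * Fintype.card l) := by
  rw [mul_comm (Fintype.card k), ← Nat.card_eq_fintype_card (α := k),
    ← Nat.card_eq_fintype_card (α := l), ← card_matrix, mul_assoc, ← Nat.card_prod,
    ← Nat.card_prod, Nat.card_congr (blockLowerEquiv k l F)]
  have h0 : ∀ M : Matrix (k ⊕ l) (k ⊕ l) F, (fromBlocks 1 0 0 0 : Matrix (k ⊕ l) (k ⊕ l) F) * M *
        (1 - fromBlocks 1 0 0 0) = 0 ↔ M.toBlocks₁₂ = 0 := by
    intro M
    rw [one_sub_corner, ← fromBlocks_toBlocks M, fromBlocks_multiply, fromBlocks_multiply,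
      ← fromBlocks_zero, fromBlocks_inj]
    simp
  refine Nat.card_congr (Equiv.subtypeEquivRight fun A => ?_)
  rw [h0, h0]
  refine ⟨fun h => h.1, fun h => ⟨h, ?_⟩⟩
  obtain ⟨a, d, x, rfl⟩ := exists_eq_blockLower h
  rw [val_inv_blockLower, toBlocks_fromBlocks₁₂]

/-- The number of invertible symmetric matrices with rows and columns indexed by `ι`. -/
def symmCount (ι F : Type*) [Field F] [Fintype ι] [DecidableEq ι] : ℕ :=
  Nat.card {S : Matrix ι ι F // S.IsSymm ∧ S.det ≠ 0}

theorem symmCount_eq_card_GL : symmCount k F = Nat.card {A : GL k F // A.val.IsSymm} :=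
  Nat.card_congr ⟨fun S => ⟨GeneralLinearGroup.mkOfDetNeZero S.1 S.2.2, S.2.1⟩,
    fun A => ⟨A.1.val, A.2, A.1.det.ne_zero⟩, fun S => rfl, fun A => by ext1; ext1; rfl⟩

/-- For `E = [1 0; 0 0]` the matrix `E A` is symmetric exactly when `A = [a 0; x d]` with `a`
symmetric. -/
theorem sum_isSymm_corner [Fintype F] [DecidableEq F] (ψ : AddChar F ℂ) :
    (∑ A : GL (k ⊕ l) F,
      if ((fromBlocks 1 0 0 0 : Matrix (k ⊕ l) (k ⊕ l) F) * A.val).IsSymm then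
        ψ (A.val * (1 - fromBlocks 1 0 0 0) + (A⁻¹).val * (1 - fromBlocks 1 0 0 0)).trace else 0) =
    symmCount k F * Fintype.card F ^ (Fintype.card k * Fintype.card l) *
      ∑ d : GL l F, ψ (d.val.trace + (d⁻¹).val.trace) := by
  classical
  have h0 : ∀ M : Matrix (k ⊕ l) (k ⊕ l) F,
      ((fromBlocks 1 0 0 0 : Matrix (k ⊕ l) (k ⊕ l) F) * M).IsSymm ↔
        M.toBlocks₁₂ = 0 ∧ M.toBlocks₁₁.IsSymm := by
    intro M
    rw [← fromBlocks_toBlocks M, fromBlocks_multiply, IsSymm, fromBlocks_transpose, fromBlocks_inj]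
    simp [IsSymm, and_comm, eq_comm]
  simp_rw [h0, ite_and]
  rw [← Finset.sum_filter, ← Finset.sum_subtype_eq_sum_filter]
  rw [Finset.subtype_univ, ← (blockLowerEquiv k l F).sum_comp]
  simp only [coe_blockLowerEquiv, val_inv_blockLower, val_blockLower, toBlocks_fromBlocks₁₁,
    one_sub_corner, fromBlocks_multiply, fromBlocks_add, trace_fromBlocks]
  simp only [Matrix.mul_zero, Matrix.mul_one, add_zero, zero_add, trace_zero, trace_add]
  rw [Fintype.sum_prod_type]
  simp only [Fintype.sum_prod_type, Finset.sum_const, Finset.card_univ]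
  simp only [← Nat.card_eq_fintype_card, card_matrix]
  simp only [Nat.card_eq_fintype_card]
  simp only [nsmul_eq_mul, ← Finset.mul_sum]
  have h1 : ∀ a : GL k F, (∑ d : GL l F, if a.val.IsSymm then
      ψ (d.val.trace + (d⁻¹).val.trace) else 0) = (if a.val.IsSymm then (1 : ℂ) else 0) *
      ∑ d : GL l F, ψ (d.val.trace + (d⁻¹).val.trace) := by
    intro a
    split_ifs <;> simp
  simp only [h1, ← Finset.sum_mul, Finset.sum_boole, symmCount_eq_card_GL,
    Nat.card_eq_fintype_card, Fintype.card_subtype, mul_comm (Fintype.card l)]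
  push_cast
  ring

theorem symmCount_reindex (e : k ≃ l) : symmCount l F = symmCount k F :=
  Nat.card_congr ((reindexAlgEquiv F F e).toEquiv.subtypeEquiv fun S => by
    change _ ↔ (reindexAlgEquiv F F e S).IsSymm ∧ (reindexAlgEquiv F F e S).det ≠ 0
    rw [isSymm_reindexAlgEquiv_iff, det_reindexAlgEquiv]).symm

end

/-! ### Counting alternating, invertible and symmetric invertible matrices -/

section

variable {F : Type*} [Field F] [Fintype F]

theorem card_alternating_fin (n : ℕ) :
    Nat.card (alternating (Fin n) F) = Fintype.card F ^ n.choose 2 := by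
  induction n with
  | zero =>
    have : Subsingleton (alternating (Fin 0) F) := ⟨fun A B => Subtype.ext (Subsingleton.elim _ _)⟩
    rw [Nat.card_unique, Nat.choose_zero_succ, pow_zero]
  | succ n ih =>
    have h1 : Nat.card (alternating (Fin 1) F) = 1 := by
      refine Nat.card_eq_one_iff_unique.2 ⟨⟨fun A B => Subtype.ext (ext fun i j => ?_)⟩, ⟨0⟩⟩
      rw [Subsingleton.elim j i, A.2.1, B.2.1]
    rw [card_alternating_reindex (finSumFinEquiv (m := n) (n := 1)), card_alternating_sum, ih, h1,
      Fintype.card_fin, Fintype.card_fin, ← pow_add, mul_one, mul_one, Nat.choose_succ_succ' n 1,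
      Nat.choose_one_right, add_comm]

theorem card_GL_succ (n : ℕ) : (Nat.card (GL (Fin (n + 1)) F) : ℂ) =
    ((Fintype.card F : ℂ) ^ (n + 1) - 1) * (Fintype.card F : ℂ) ^ n * Nat.card (GL (Fin n) F) := by
  have hc : ∀ m : ℕ, (Nat.card (GL (Fin m) F) : ℂ) =
      ∏ i ∈ Finset.range m, ((Fintype.card F : ℂ) ^ m - (Fintype.card F : ℂ) ^ i) := by
    intro m
    rw [card_GL_field, Nat.cast_prod, ← Fin.prod_univ_eq_prod_range
      (fun i => ((Fintype.card F : ℂ) ^ m - (Fintype.card F : ℂ) ^ i))]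
    refine Finset.prod_congr rfl fun i _ => ?_
    rw [Nat.cast_sub (Nat.pow_le_pow_right Fintype.card_pos i.2.le)]
    push_cast
    rfl
  rw [hc, hc, Finset.prod_range_succ', pow_zero, mul_comm, mul_assoc]
  congr 1
  have hpow : (Fintype.card F : ℂ) ^ n = ∏ _i ∈ Finset.range n, (Fintype.card F : ℂ) := by simp
  conv_rhs => enter [1]; rw [hpow]
  rw [← Finset.prod_mul_distrib]
  refine Finset.prod_congr rfl fun i _ => ?_
  ring

end

section

variable {k l F : Type*} [Field F] [Fintype F] [Fintype k] [Fintype l]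
  [DecidableEq k] [DecidableEq l]

/-- Symmetric matrices `[x b; ᵗb D]` with a single row in the first block. -/
theorem card_isSymm_sum [Unique k] (p : Matrix (k ⊕ l) (k ⊕ l) F → Prop) :
    Nat.card {S : Matrix (k ⊕ l) (k ⊕ l) F // S.IsSymm ∧ p S} =
      ∑ x : F, ∑ b : Matrix k l F, Nat.card {D : Matrix l l F //
        D.IsSymm ∧ p (fromBlocks (of fun _ _ => x) b bᵀ D)} := by
  simp only [← Nat.card_sigma]
  have hx : ∀ M : Matrix k k F, (of fun _ _ => M default default) = M := fun M => by
    ext i j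
    rw [of_apply, Subsingleton.elim i default, Subsingleton.elim j default]
  have hS : ∀ S : Matrix (k ⊕ l) (k ⊕ l) F, S.IsSymm →
      fromBlocks (of fun _ _ => S.toBlocks₁₁ default default) S.toBlocks₁₂ S.toBlocks₁₂ᵀ
        S.toBlocks₂₂ = S := by
    intro S h
    rw [← fromBlocks_toBlocks S, isSymm_fromBlocks_iff] at h
    rw [hx, h.2.1, fromBlocks_toBlocks]
  refine Nat.card_congr ⟨fun S => ⟨S.1.toBlocks₁₁ default default, S.1.toBlocks₁₂,
    S.1.toBlocks₂₂, ?_, ?_⟩, fun y => ⟨fromBlocks (of fun _ _ => y.1) y.2.1 y.2.1ᵀ y.2.2.1, ?_, ?_⟩,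
    fun S => ?_, fun y => ?_⟩
  · have h := S.2.1
    rw [← fromBlocks_toBlocks S.1, isSymm_fromBlocks_iff] at h
    exact h.2.2.2
  · rw [hS _ S.2.1]
    exact S.2.2
  · exact IsSymm.fromBlocks rfl rfl y.2.2.2.1
  · exact y.2.2.2.2
  · exact Subtype.ext (hS _ S.2.1)
  · rfl

/-- Taking the Schur complement of an invertible symmetric block. -/
theorem card_isSymm_schur {k l F : Type*} [Field F] [Fintype k] [Fintype l] [DecidableEq k]
    [DecidableEq l] {K : Matrix k k F} (hK : K.IsSymm) (hdet : K.det ≠ 0)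
    (b : Matrix k l F) :
    Nat.card {D : Matrix l l F // D.IsSymm ∧ (fromBlocks K b bᵀ D).det ≠ 0} = symmCount l F := by
  refine Nat.card_congr ((Equiv.subRight (bᵀ * K⁻¹ * b)).subtypeEquiv fun D => ?_)
  let := invertibleOfIsUnitDet K (isUnit_iff_ne_zero.2 hdet)
  rw [det_fromBlocks₁₁, invOf_eq_nonsing_inv, Equiv.subRight_apply, mul_ne_zero_iff,
    and_iff_right hdet]
  have h : (bᵀ * K⁻¹ * b).IsSymm := by
    rw [IsSymm, transpose_mul, transpose_mul, transpose_transpose, hK.inv.eq, Matrix.mul_assoc]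
  refine and_congr_left fun _ => ⟨fun hD => hD.sub h, fun hD => ?_⟩
  simpa using hD.add h

theorem card_isSymm_reindex {k l F : Type*} [Field F] [Fintype k] [Fintype l] [DecidableEq k]
    [DecidableEq l] (e : k ≃ l) (p : Matrix l l F → Prop) :
    Nat.card {S : Matrix l l F // S.IsSymm ∧ p S} =
      Nat.card {S : Matrix k k F // S.IsSymm ∧ p (reindexAlgEquiv F F e S)} :=
  Nat.card_congr ((reindexAlgEquiv F F e).toEquiv.subtypeEquiv fun S => by
    change _ ↔ (reindexAlgEquiv F F e S).IsSymm ∧ p (reindexAlgEquiv F F e S)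
    rw [isSymm_reindexAlgEquiv_iff]).symm

/-- If the corner entry of a symmetric matrix is `0` but its first row is not, a nonzero entry of
the first row gives an invertible symmetric `2 × 2` block `[0 v; v x]`, of which one takes the Schur
complement. -/
theorem card_isSymm_zero_corner {u : Type*} [Unique u] [Fintype u] [DecidableEq u]
    {b : Matrix u l F} {j : l} (hj : b default j ≠ 0) :
    Nat.card {D : Matrix l l F // D.IsSymm ∧ (fromBlocks 0 b bᵀ D).det ≠ 0} =
      Fintype.card F ^ Fintype.card l * symmCount {i // ¬ i = j} F := by
  let e : {i // i = j} ⊕ {i // ¬ i = j} ≃ l := Equiv.sumCompl (fun i => i = j)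
  rw [card_isSymm_reindex e, card_isSymm_sum]
  have key : ∀ (x : F) (y : Matrix {i // i = j} {i // ¬ i = j} F),
      Nat.card {D : Matrix {i // ¬ i = j} {i // ¬ i = j} F // D.IsSymm ∧
        (fromBlocks 0 b bᵀ (reindexAlgEquiv F F e
          (fromBlocks (of fun _ _ => x) y yᵀ D))).det ≠ 0} = symmCount {i // ¬ i = j} F := by
    intro x y
    let v : Matrix u {i // i = j} F := b.submatrix id (e ∘ Sum.inl)
    let K : Matrix (u ⊕ {i // i = j}) (u ⊕ {i // i = j}) F :=
      fromBlocks 0 v vᵀ (of fun _ _ => x)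
    have hv : v default default = b default j := rfl
    have hKdet : K.det ≠ 0 := by
      let K' : Matrix (u ⊕ {i // i = j}) (u ⊕ {i // i = j}) F :=
        fromBlocks (of fun _ _ => -x / b default j ^ 2) (of fun _ _ => (b default j)⁻¹)
          (of fun _ _ => (b default j)⁻¹) 0
      refine det_ne_zero_of_right_inverse (B := K') ?_
      rw [fromBlocks_multiply, ← fromBlocks_one, fromBlocks_inj]
      refine ⟨?_, ?_, ?_, ?_⟩ <;> ext s t <;>
        rw [Subsingleton.elim s default, Subsingleton.elim t default] <;> simp [mul_apply, hv, hj]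
      field_simp
      simp
    rw [← card_isSymm_schur (K := K) (IsSymm.fromBlocks (by simp [IsSymm]) rfl rfl) hKdet
      (fromRows (b.submatrix id (e ∘ Sum.inr)) y)]
    refine Nat.card_congr (Equiv.subtypeEquivRight fun D => and_congr_right fun _ => ?_)
    rw [← det_submatrix_equiv_self
      ((Equiv.sumAssoc u {i // i = j} {i // ¬ i = j}).trans (Equiv.sumCongr (Equiv.refl u) e))]
    refine Iff.of_eq (congrArg (fun M => det M ≠ 0) ?_)
    ext ((s | s) | s) ((t | t) | t) <;>
      simp [K, v, coe_reindexAlgEquiv]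
  simp only [key, Finset.sum_const, Finset.card_univ, smul_eq_mul]
  rw [← Nat.card_eq_fintype_card (α := Matrix _ _ F), card_matrix,
    Nat.card_unique (α := {i // i = j}), one_mul, ← mul_assoc, ← pow_succ',
    Nat.card_eq_fintype_card, ← Fintype.card_congr e, Fintype.card_sum,
    Fintype.card_unique (α := {i // i = j}), add_comm]

/-- The recursion according to the corner entry `x`: for `x ≠ 0` one takes the Schur complement of
`x`; for `x = 0` the first row must not vanish. For `m = 0` there is no such row, in accordance with
the factor `q ^ m - 1 = 0`, and the value of `m - 1` does not matter. -/
theorem symmCount_unit_sum [DecidableEq F] (m : ℕ) (hm : Fintype.card l = m) :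
    symmCount (Unit ⊕ l) F = (Fintype.card F - 1) * Fintype.card F ^ m * symmCount l F +
      (Fintype.card F ^ m - 1) * (Fintype.card F ^ m * symmCount (Fin (m - 1)) F) := by
  classical
  have hcard : Fintype.card (Matrix Unit l F) = Fintype.card F ^ m := by
    rw [← Nat.card_eq_fintype_card, card_matrix]
    simp [hm]
  rw [symmCount, card_isSymm_sum, ← Finset.add_sum_erase _ _ (Finset.mem_univ (0 : F)), add_comm]
  congr 1
  · rw [Finset.sum_congr rfl (g := fun _ => Fintype.card F ^ m * symmCount l F) fun x hx => ?_]
    · rw [Finset.sum_const, Finset.card_erase_of_mem (Finset.mem_univ _), Finset.card_univ,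
        smul_eq_mul, mul_assoc]
    · have hx0 := Finset.ne_of_mem_erase hx
      rw [Finset.sum_congr rfl fun b _ => card_isSymm_schur (by ext; rfl)
        (by simpa using hx0) b, Finset.sum_const, Finset.card_univ, hcard, smul_eq_mul]
  · rw [← Finset.add_sum_erase _ _ (Finset.mem_univ (0 : Matrix Unit l F))]
    have h0 : (of fun _ _ => (0 : F) : Matrix Unit Unit F) = 0 := by ext; rfl
    simp only [h0]
    have hz : Nat.card {D : Matrix l l F // D.IsSymm ∧
        (fromBlocks (0 : Matrix Unit Unit F) 0 0ᵀ D).det ≠ 0} = 0 := by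
      rw [Nat.card_eq_zero]
      refine Or.inl ⟨fun D => D.2.2 (det_eq_zero_of_row_eq_zero (Sum.inl ()) fun t => ?_)⟩
      rcases t with t | t <;> simp
    rw [hz, zero_add, Finset.sum_congr rfl
      (g := fun _ => Fintype.card F ^ m * symmCount (Fin (m - 1)) F) fun b hb => ?_,
      Finset.sum_const, Finset.card_erase_of_mem (Finset.mem_univ _), Finset.card_univ, hcard,
      smul_eq_mul]
    obtain ⟨j, hj⟩ : ∃ j, b () j ≠ 0 := by
      by_contra! h
      exact Finset.ne_of_mem_erase hb (ext fun _ j => h j)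
    have e : {i // ¬ i = j} ≃ Fin (m - 1) := Fintype.equivOfCardEq (by
      rw [Fintype.card_subtype_compl, hm, Fintype.card_subtype_eq, Fintype.card_fin])
    rw [card_isSymm_zero_corner hj, hm, symmCount_reindex e]

theorem symmCount_succ [DecidableEq F] (n : ℕ) : (symmCount (Fin (n + 1)) F : ℂ) =
    (Fintype.card F - 1) * (Fintype.card F : ℂ) ^ n * symmCount (Fin n) F +
      ((Fintype.card F : ℂ) ^ n - 1) * ((Fintype.card F : ℂ) ^ n * symmCount (Fin (n - 1)) F) := by
  have e : Unit ⊕ Fin n ≃ Fin (n + 1) := Fintype.equivOfCardEq (by simp [add_comm])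
  rw [symmCount_reindex e, symmCount_unit_sum n (Fintype.card_fin n), Nat.cast_add, Nat.cast_mul,
    Nat.cast_mul,
    Nat.cast_mul, Nat.cast_mul, Nat.cast_sub Fintype.card_pos,
    Nat.cast_sub (Nat.pow_pos Fintype.card_pos)]
  push_cast
  rfl

theorem symmCount_zero {F : Type*} [Field F] : symmCount (Fin 0) F = 1 :=
  Nat.card_eq_one_iff_unique.2 ⟨⟨fun A B => Subtype.ext (Subsingleton.elim _ _)⟩,
    ⟨⟨1, isSymm_one, by simp⟩⟩⟩

/-- The number of invertible symmetric matrices of even size `2m` and of odd size `2m + 1`. -/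
theorem symmCount_eq [DecidableEq F] (m : ℕ) :
    (symmCount (Fin (2 * m)) F : ℂ) = (Fintype.card F : ℂ) ^ (m * (m + 1)) *
        ∏ j ∈ Finset.Icc 1 m, ((Fintype.card F : ℂ) ^ (2 * j - 1) - 1) ∧
      (symmCount (Fin (2 * m + 1)) F : ℂ) = (Fintype.card F : ℂ) ^ (m * (m + 1)) *
        ∏ j ∈ Finset.Icc 1 (m + 1), ((Fintype.card F : ℂ) ^ (2 * j - 1) - 1) := by
  induction m with
  | zero =>
    have h := symmCount_succ (F := F) 0
    rw [symmCount_zero] at h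
    simp [symmCount_zero, h]
  | succ m ih =>
    have hp : ∀ N : ℕ, ∏ j ∈ Finset.Icc 1 (N + 1), ((Fintype.card F : ℂ) ^ (2 * j - 1) - 1) =
        (∏ j ∈ Finset.Icc 1 N, ((Fintype.card F : ℂ) ^ (2 * j - 1) - 1)) *
          ((Fintype.card F : ℂ) ^ (2 * N + 1) - 1) := fun N =>
      Finset.prod_Icc_succ_top (by omega) _
    have h1 : (symmCount (Fin (2 * (m + 1))) F : ℂ) =
        (Fintype.card F : ℂ) ^ ((m + 1) * (m + 1 + 1)) *
        ∏ j ∈ Finset.Icc 1 (m + 1), ((Fintype.card F : ℂ) ^ (2 * j - 1) - 1) := by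
      rw [show 2 * (m + 1) = 2 * m + 1 + 1 by ring, symmCount_succ, Nat.add_sub_cancel, ih.1, ih.2,
        hp]
      ring
    refine ⟨h1, ?_⟩
    rw [symmCount_succ, h1, show 2 * (m + 1) - 1 = 2 * m + 1 by omega, ih.2, hp (m + 1)]
    ring

end

/-! ### The Kloosterman sum over `GL(2,q)` -/

section

variable {F : Type*} [Field F] [Fintype F] [DecidableEq F]

theorem sum_units (g : F → ℂ) : ∑ u : Fˣ, g u = ∑ x : F, if x ≠ 0 then g x else 0 := by
  rw [← Finset.sum_filter, ← Finset.sum_subtype_eq_sum_filter, Finset.subtype_univ]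
  exact Fintype.sum_equiv unitsEquivNeZero _ _ fun u => rfl

theorem kloosterman_one_eq (ψ : AddChar F ℂ) :
    kloosterman ψ 1 = ∑ x : F, if x ≠ 0 then ψ (x + x⁻¹) else 0 := by
  rw [← sum_units fun x => ψ (x + x⁻¹)]
  simp [kloosterman]

/-- For `b = 0` the product `b c` is always `0`, and for each `b ≠ 0` it takes every value once. -/
theorem sum_sum_mul (g : F → ℂ) :
    ∑ b : F, ∑ c : F, g (b * c) = Fintype.card F * g 0 + (Fintype.card F - 1) * ∑ z, g z := by
  rw [← Finset.add_sum_erase _ _ (Finset.mem_univ (0 : F))]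
  congr 1
  · simp
  · rw [Finset.sum_congr rfl (g := fun _ => ∑ z, g z) fun b hb =>
      Fintype.sum_equiv (Equiv.mulLeft₀ b (Finset.ne_of_mem_erase hb)) _ _ fun c => rfl]
    rw [Finset.sum_const, Finset.card_erase_of_mem (Finset.mem_univ _), Finset.card_univ,
      nsmul_eq_mul, Nat.cast_sub Fintype.card_pos, Nat.cast_one]

theorem sum_sum_sum_char {ψ : AddChar F ℂ} (hψ : ψ ≠ 1) :
    (∑ a : F, ∑ e : F, ∑ d : F, if d ≠ 0 then ψ ((a + e) * (1 + d⁻¹)) else 0) =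
      (Fintype.card F : ℂ) ^ 2 := by
  have hprim := AddChar.IsPrimitive.of_ne_one hψ
  have h1 : ∀ d : F, (∑ a : F, ∑ e : F, if d ≠ 0 then ψ ((a + e) * (1 + d⁻¹)) else 0) =
      if d = -1 then (Fintype.card F : ℂ) ^ 2 else 0 := by
    intro d
    by_cases hd : d = 0
    · simp [hd]
    · have h2 : 1 + d⁻¹ = 0 ↔ d = -1 := by
        rw [add_eq_zero_iff_eq_neg', inv_eq_iff_eq_inv, inv_neg_one]
      simp only [ne_eq, hd, not_false_eq_true, if_true, add_mul, AddChar.map_add_eq_mul,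
        ← Finset.mul_sum, ← Finset.sum_mul, AddChar.sum_mulShift _ hprim, h2]
      split_ifs <;> simp [sq]
  rw [Finset.sum_congr rfl fun a _ => Finset.sum_comm, Finset.sum_comm]
  simp only [h1, Finset.sum_ite_eq', Finset.mem_univ, if_true]

theorem sum_sum_mul_char (ψ : AddChar F ℂ) :
    (∑ a : F, ∑ e : F, if a * e ≠ 0 then ψ ((a + e) * (1 + (a * e)⁻¹)) else 0) =
      kloosterman ψ 1 ^ 2 := by
  rw [kloosterman_one_eq, sq, Finset.sum_mul_sum]
  refine Finset.sum_congr rfl fun a _ => Finset.sum_congr rfl fun e _ => ?_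
  by_cases ha : a = 0
  · simp [ha]
  by_cases he : e = 0
  · simp [he]
  simp only [ne_eq, mul_eq_zero, ha, he, or_self, not_false_eq_true, if_true,
    ← AddChar.map_add_eq_mul]
  congr 1
  field_simp
  ring

theorem kloostermanGL_one_one (ψ : AddChar F ℂ) : kloostermanGL 1 ψ 1 = kloosterman ψ 1 := by
  refine Fintype.sum_equiv (Units.mapEquiv (uniqueRingEquiv (m := Fin 1)).toMulEquiv).toEquiv _ _
    fun w => ?_
  simp only [trace_fin_one, one_mul]
  rfl

/-- With `w = [a b; c e]` and `d = det w`, one has `Tr w + Tr w⁻¹ = (a + e) (1 + d⁻¹)`, and for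
given `a` and `e` the determinant depends on `b c` only. -/
theorem kloostermanGL_two_one {ψ : AddChar F ℂ} (hψ : ψ ≠ 1) :
    kloostermanGL 2 ψ 1 =
      Fintype.card F * (kloosterman ψ 1 ^ 2 + (Fintype.card F : ℂ) ^ 2 - Fintype.card F) := by
  have h1 : kloostermanGL 2 ψ 1 = ∑ M : Matrix (Fin 2) (Fin 2) F,
      if M.det ≠ 0 then ψ (M.trace * (1 + M.det⁻¹)) else 0 := by
    rw [← Finset.sum_filter, ← Finset.sum_subtype_eq_sum_filter, Finset.subtype_univ]
    refine Fintype.sum_equiv ⟨fun w : GL (Fin 2) F => ⟨w.val, w.det.ne_zero⟩,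
      fun M => GeneralLinearGroup.mkOfDetNeZero M.1 M.2, fun w => by ext1; rfl, fun M => rfl⟩
      _ _ fun w => ?_
    change ψ _ = ψ (w.val.trace * (1 + w.val.det⁻¹))
    rw [coe_units_inv, inv_def, trace_smul, adjugate_fin_two, trace_fin_two_of, trace_fin_two,
      Ring.inverse_eq_inv', smul_eq_mul]
    congr 1
    ring
  have h2 : kloostermanGL 2 ψ 1 = ∑ a : F, ∑ e : F, ∑ b : F, ∑ c : F,
      if a * e - b * c ≠ 0 then ψ ((a + e) * (1 + (a * e - b * c)⁻¹)) else 0 := by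
    rw [h1]
    simp only [← Fintype.sum_prod_type']
    refine (Fintype.sum_equiv ⟨fun x : F × F × F × F => !![x.1, x.2.2.1; x.2.2.2, x.2.1],
      fun M => (M 0 0, M 1 1, M 0 1, M 1 0), fun x => rfl,
      fun M => (eta_fin_two M).symm⟩ _ _ fun x => ?_).symm
    rw [det_fin_two, trace_fin_two]
    rfl
  rw [h2]
  have h3 : ∀ a e : F, (∑ b : F, ∑ c : F,
      if a * e - b * c ≠ 0 then ψ ((a + e) * (1 + (a * e - b * c)⁻¹)) else 0) =
      Fintype.card F * (if a * e ≠ 0 then ψ ((a + e) * (1 + (a * e)⁻¹)) else 0) +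
      (Fintype.card F - 1) * ∑ d : F, if d ≠ 0 then ψ ((a + e) * (1 + d⁻¹)) else 0 := by
    intro a e
    rw [sum_sum_mul fun z => if a * e - z ≠ 0 then ψ ((a + e) * (1 + (a * e - z)⁻¹)) else 0,
      sub_zero]
    congr 2
    exact Fintype.sum_equiv (Equiv.subLeft (a * e)) _ _ fun z => rfl
  simp only [h3, Finset.sum_add_distrib, ← Finset.mul_sum, sum_sum_sum_char hψ, sum_sum_mul_char]
  ring

end

/-! ### The double coset sums -/

section

variable {F : Type*} [Field F]

theorem parabolic_eq_image_siegel (n : ℕ) :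
    parabolic n F = Units.val '' (siegel (Fin n) F : Set (GL (Fin n ⊕ Fin n) F)) := by
  have h : ∀ (A : GL (Fin n) F) (B : Matrix (Fin n) (Fin n) F),
      fromBlocks A.val 0 0 (A⁻¹).valᵀ * fromBlocks 1 B 0 1 = (parabolicElement A B).val := by
    intro A B
    simp [parabolicElement, fromBlocks_multiply]
  ext w
  constructor
  · rintro ⟨A, B, hB, rfl⟩
    exact ⟨_, mem_siegel_iff_exists.2 ⟨A, B, hB, rfl⟩, (h A B).symm⟩
  · rintro ⟨w, hw, rfl⟩
    obtain ⟨A, B, hB, rfl⟩ := mem_siegel_iff_exists.1 hw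
    exact ⟨A, B, hB, (h A B).symm⟩

theorem sigma_eq_weyl (r l : ℕ) :
    ∃ hE : reindexAlgEquiv F F (finSumFinEquiv (m := r) (n := l)) (fromBlocks 1 0 0 0) *
      reindexAlgEquiv F F finSumFinEquiv (fromBlocks 1 0 0 0) =
      reindexAlgEquiv F F finSumFinEquiv (fromBlocks 1 0 0 0),
    sigma (r + l) r F = (weyl _ hE).val := by
  have hE : reindexAlgEquiv F F (finSumFinEquiv (m := r) (n := l)) (fromBlocks 1 0 0 0) =
      diagonal fun i : Fin (r + l) => if (i : ℕ) < r then (1 : F) else 0 := by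
    rw [coe_reindexAlgEquiv, ← Equiv.eq_symm_apply, reindex_symm, ← diagonal_one, ← diagonal_zero,
      fromBlocks_diagonal]
    ext (i | i) (j | j) <;> simp [diagonal_apply, Fin.ext_iff]
    omega
  refine ⟨?_, ?_⟩
  · rw [← map_mul, fromBlocks_multiply]
    simp
  · simp only [weyl, hE, sigma]
    rw [← diagonal_one, diagonal_sub]
    congr 2 <;> ext i <;> split_ifs <;> simp

theorem traceSum_image_doubleCoset {m : Type*} [Fintype F] [Fintype m] [DecidableEq m]
    (ψ : AddChar F ℂ) (H : Subgroup (GL m F)) (g : GL m F) :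
    traceSum ψ (DoubleCoset.doubleCoset g.val (Units.val '' (H : Set (GL m F)))
      (Units.val '' (H : Set (GL m F)))) =
    ∑ w ∈ (DoubleCoset.doubleCoset g (H : Set (GL m F)) H).toFinite.toFinset,
      ψ w.val.trace := by
  refine (Finset.sum_bij (fun w _ => w.val) (fun w hw => ?_) (fun _ _ _ _ h => Units.ext h)
    (fun w hw => ?_) fun _ _ => rfl).symm
  · rw [Set.Finite.mem_toFinset, DoubleCoset.mem_doubleCoset] at hw ⊢
    obtain ⟨x, hx, y, hy, rfl⟩ := hw
    exact ⟨_, ⟨x, hx, rfl⟩, _, ⟨y, hy, rfl⟩, rfl⟩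
  · rw [Set.Finite.mem_toFinset, DoubleCoset.mem_doubleCoset] at hw
    obtain ⟨_, ⟨x, hx, rfl⟩, _, ⟨y, hy, rfl⟩, rfl⟩ := hw
    refine ⟨x * g * y, ?_, rfl⟩
    rw [Set.Finite.mem_toFinset, DoubleCoset.mem_doubleCoset]
    exact ⟨x, hx, y, hy, rfl⟩

variable [Fintype F]

theorem card_pow_sub_one_ne_zero {k : ℕ} (hk : k ≠ 0) : (Fintype.card F : ℂ) ^ k - 1 ≠ 0 := by
  rw [sub_ne_zero]
  exact_mod_cast (Nat.one_lt_pow hk Fintype.one_lt_card).ne'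

theorem card_GL_ne_zero (r : ℕ) : (Nat.card (GL (Fin r) F) : ℂ) ≠ 0 :=
  Nat.cast_ne_zero.2 Nat.card_pos.ne'

theorem card_GL_one : (Nat.card (GL (Fin 1) F) : ℂ) = Fintype.card F - 1 := by
  have h0 : Nat.card (GL (Fin 0) F) = 1 := by
    rw [card_GL_field]
    simp
  rw [card_GL_succ 0, h0]
  simp

theorem card_GL_two : (Nat.card (GL (Fin 2) F) : ℂ) =
    ((Fintype.card F : ℂ) ^ 2 - 1) * Fintype.card F * (Fintype.card F - 1) := by
  rw [card_GL_succ 1, card_GL_one, pow_one]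

theorem two_mul_choose_two (r : ℕ) : r.choose 2 * 2 + r = r ^ 2 := by
  induction r with
  | zero => rfl
  | succ r ih =>
    rw [Nat.choose_succ_succ' r 1, Nat.choose_one_right]
    linarith

variable [DecidableEq F]

/-- The exponential sum over `P⁺ σ_r⁺ P⁺` in `O⁺(2(r+l),q)`. -/
theorem traceSum_doubleCoset_sigma {ψ : AddChar F ℂ} (hψ : ψ ≠ 1) (r l : ℕ) :
    (Nat.card (GL (Fin r) F) * Nat.card (GL (Fin l) F) : ℂ) *
      traceSum ψ (DoubleCoset.doubleCoset (sigma (r + l) r F) (parabolic (r + l) F)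
        (parabolic (r + l) F)) =
    Nat.card (GL (Fin (r + l)) F) *
      (Fintype.card F : ℂ) ^ (r.choose 2 * 2 + r * l + l.choose 2) * symmCount (Fin r) F *
        kloostermanGL l ψ 1 := by
  obtain ⟨hE, hσ⟩ := sigma_eq_weyl (F := F) r l
  have hs : (reindexAlgEquiv F F (finSumFinEquiv (m := r) (n := l))
      (fromBlocks 1 0 0 0)).IsSymm := by
    rw [isSymm_reindexAlgEquiv_iff]
    exact IsSymm.fromBlocks isSymm_one (by simp) (by simp [IsSymm])
  have h := sum_doubleCoset_weyl hψ hE hs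
  rw [card_corner_reindex, card_alternating_corner_reindex, sum_isSymm_reindex, card_corner,
    card_alternating_corner, sum_isSymm_corner,
    card_alternating_reindex (finSumFinEquiv (m := r) (n := l)), card_alternating_sum,
    card_alternating_fin, card_alternating_fin, Fintype.card_fin, Fintype.card_fin] at h
  rw [parabolic_eq_image_siegel, hσ, traceSum_image_doubleCoset]
  have hK : kloostermanGL l ψ 1 = ∑ d : GL (Fin l) F, ψ (d.val.trace + (d⁻¹).val.trace) := by
    simp only [kloostermanGL, one_mul]
  have hq : (Fintype.card F : ℂ) ≠ 0 := Nat.cast_ne_zero.2 Fintype.card_ne_zero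
  rw [← hK] at h
  push_cast at h
  -- the power of `q` in the order of `P ∩ σ P σ`, which cancels
  refine mul_left_cancel₀ (pow_ne_zero (r * l * 2 + l.choose 2) hq) ?_
  refine Eq.trans ?_ (h.trans ?_) <;> ring

theorem traceSum_DC₁ {ψ : AddChar F ℂ} (hψ : ψ ≠ 1) (r : ℕ) :
    traceSum ψ (DC₁ (r + 1) F) = (Fintype.card F : ℂ) ^ (r ^ 2 + r) *
      (qBinom (r + 1) 1 (Fintype.card F) : ℂ) * symmCount (Fin r) F * kloosterman ψ 1 := by
  have h := traceSum_doubleCoset_sigma hψ r 1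
  rw [card_GL_succ r, card_GL_one, kloostermanGL_one_one, show Nat.choose 1 2 = 0 from rfl] at h
  have hr := card_GL_ne_zero (F := F) r
  have hq1 := card_pow_sub_one_ne_zero (F := F) one_ne_zero
  rw [pow_one] at hq1
  rw [DC₁, Nat.add_sub_cancel, qBinom]
  simp only [Finset.prod_range_one, Nat.sub_zero, pow_one]
  push_cast
  refine mul_left_cancel₀ (mul_ne_zero hr hq1) ?_
  rw [h, ← two_mul_choose_two]
  field_simp
  ring

theorem traceSum_DC₂ {ψ : AddChar F ℂ} (hψ : ψ ≠ 1) (r : ℕ) :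
    traceSum ψ (DC₂ (r + 2) F) = (Fintype.card F : ℂ)⁻¹ *
      ((Fintype.card F : ℂ) ^ (r ^ 2 + 3 * r + 2) *
      (qBinom (r + 2) 2 (Fintype.card F) : ℂ) * symmCount (Fin r) F) * kloostermanGL 2 ψ 1 := by
  have h := traceSum_doubleCoset_sigma hψ r 2
  rw [card_GL_succ (r + 1), card_GL_succ r, card_GL_two] at h
  have hr := card_GL_ne_zero (F := F) r
  have hq : (Fintype.card F : ℂ) ≠ 0 := Nat.cast_ne_zero.2 Fintype.card_ne_zero
  have hq1 := card_pow_sub_one_ne_zero (F := F) one_ne_zero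
  have hq2 := card_pow_sub_one_ne_zero (F := F) two_ne_zero
  rw [pow_one] at hq1
  rw [DC₂, Nat.add_sub_cancel, qBinom]
  simp only [Finset.prod_range_succ, Finset.prod_range_zero, one_mul, Nat.sub_zero,
    show r + 2 - 1 = r + 1 from rfl, show 2 - 1 = 1 from rfl, pow_one]
  push_cast
  refine mul_left_cancel₀ (mul_ne_zero hr (mul_ne_zero hq (mul_ne_zero hq1 hq2))) ?_
  rw [Nat.choose_self] at h
  calc _ = _ := by ring
    _ = _ := h
    _ = _ := by
      rw [← two_mul_choose_two]
      field_simp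
      ring

theorem cast_prod_Icc (N q : ℕ) :
    ((∏ j ∈ Finset.Icc 1 N, ((q : ℚ) ^ (2 * j - 1) - 1) : ℚ) : ℂ) =
      ∏ j ∈ Finset.Icc 1 N, ((q : ℂ) ^ (2 * j - 1) - 1) := by
  push_cast; rfl

end

end OrthogonalExpSum

end

theorem theorem4 {F : Type*} [Field F] [Fintype F] [DecidableEq F] [CharP F 2]
    (q : ℕ) (hq : Fintype.card F = q) (ψ : AddChar F ℂ) (hψ : ψ ≠ 1) :
    (∀ n : ℕ, Even n → 2 ≤ n →
      OrthogonalExpSum.traceSum ψ (OrthogonalExpSum.DC₁ n F) =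
        (OrthogonalExpSum.A₁plus n q : ℂ) * OrthogonalExpSum.kloosterman ψ 1) ∧
    (∀ n : ℕ, Odd n →
      OrthogonalExpSum.traceSum ψ (OrthogonalExpSum.DC₁ n F) =
        (OrthogonalExpSum.A₁minus n q : ℂ) * OrthogonalExpSum.kloosterman ψ 1) ∧
    (∀ n : ℕ, Even n → 2 ≤ n →
      OrthogonalExpSum.traceSum ψ (OrthogonalExpSum.DC₂ n F) =
        (q : ℂ)⁻¹ * (OrthogonalExpSum.A₂plus n q : ℂ) * OrthogonalExpSum.kloostermanGL 2 ψ 1 ∧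
      (q : ℂ)⁻¹ * (OrthogonalExpSum.A₂plus n q : ℂ) * OrthogonalExpSum.kloostermanGL 2 ψ 1 =
        (OrthogonalExpSum.A₂plus n q : ℂ) *
          (OrthogonalExpSum.kloosterman ψ 1 ^ 2 + (q : ℂ) ^ 2 - (q : ℂ))) ∧
    (∀ n : ℕ, Odd n → 3 ≤ n →
      OrthogonalExpSum.traceSum ψ (OrthogonalExpSum.DC₂ n F) =
        (q : ℂ)⁻¹ * (OrthogonalExpSum.A₂minus n q : ℂ) * OrthogonalExpSum.kloostermanGL 2 ψ 1 ∧
      (q : ℂ)⁻¹ * (OrthogonalExpSum.A₂minus n q : ℂ) * OrthogonalExpSum.kloostermanGL 2 ψ 1 =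
        (OrthogonalExpSum.A₂minus n q : ℂ) *
          (OrthogonalExpSum.kloosterman ψ 1 ^ 2 + (q : ℂ) ^ 2 - (q : ℂ))) := by
  subst hq
  have hq0 : (Fintype.card F : ℂ) ≠ 0 := Nat.cast_ne_zero.2 Fintype.card_ne_zero
  have hK : ∀ a : ℂ, (Fintype.card F : ℂ)⁻¹ * a * OrthogonalExpSum.kloostermanGL 2 ψ 1 =
      a * (OrthogonalExpSum.kloosterman ψ 1 ^ 2 + (Fintype.card F : ℂ) ^ 2 -
        (Fintype.card F : ℂ)) := by
    intro a
    rw [OrthogonalExpSum.kloostermanGL_two_one hψ]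
    field_simp
  refine ⟨?_, ?_, fun n hn h2 => ⟨?_, hK _⟩, fun n hn h3 => ⟨?_, hK _⟩⟩
  · rintro n ⟨m, rfl⟩ h2
    obtain ⟨m, rfl⟩ : ∃ k, m = k + 1 := ⟨m - 1, by omega⟩
    have hexp : (5 * (m + 1 + (m + 1)) ^ 2 - 6 * (m + 1 + (m + 1))) / 4 =
        (2 * m + 1) ^ 2 + (2 * m + 1) + m * (m + 1) := by
      apply Nat.div_eq_of_eq_mul_left (by norm_num)
      apply Nat.sub_eq_of_eq_add
      ring
    rw [OrthogonalExpSum.A₁plus, hexp, show (m + 1 + (m + 1)) / 2 = m + 1 by omega,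
      show m + 1 + (m + 1) = 2 * m + 1 + 1 by ring, OrthogonalExpSum.traceSum_DC₁ hψ,
      (OrthogonalExpSum.symmCount_eq m).2, Rat.cast_mul, OrthogonalExpSum.cast_prod_Icc]
    push_cast
    ring
  · rintro n ⟨m, rfl⟩
    have hexp : (5 * (2 * m + 1) ^ 2 - 4 * (2 * m + 1) - 1) / 4 =
        (2 * m) ^ 2 + 2 * m + m * (m + 1) := by
      apply Nat.div_eq_of_eq_mul_left (by norm_num)
      rw [Nat.sub_sub]
      apply Nat.sub_eq_of_eq_add
      ring
    rw [OrthogonalExpSum.A₁minus, hexp, show (2 * m + 1 - 1) / 2 = m by omega,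
      OrthogonalExpSum.traceSum_DC₁ hψ,
      (OrthogonalExpSum.symmCount_eq m).1, Rat.cast_mul, OrthogonalExpSum.cast_prod_Icc]
    push_cast
    ring
  · obtain ⟨m, rfl⟩ := hn
    obtain ⟨m, rfl⟩ : ∃ k, m = k + 1 := ⟨m - 1, by omega⟩
    have hexp : (5 * (m + 1 + (m + 1)) ^ 2 - 6 * (m + 1 + (m + 1))) / 4 =
        (2 * m) ^ 2 + 3 * (2 * m) + 2 + m * (m + 1) := by
      apply Nat.div_eq_of_eq_mul_left (by norm_num)
      apply Nat.sub_eq_of_eq_add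
      ring
    rw [OrthogonalExpSum.A₂plus, hexp, show (m + 1 + (m + 1) - 2) / 2 = m by omega,
      show m + 1 + (m + 1) = 2 * m + 2 by ring, OrthogonalExpSum.traceSum_DC₂ hψ,
      (OrthogonalExpSum.symmCount_eq m).1, Rat.cast_mul, OrthogonalExpSum.cast_prod_Icc]
    push_cast
    ring
  · obtain ⟨m, rfl⟩ := hn
    obtain ⟨m, rfl⟩ : ∃ k, m = k + 1 := ⟨m - 1, by omega⟩
    have hexp : (5 * (2 * (m + 1) + 1) ^ 2 - 8 * (2 * (m + 1) + 1) + 3) / 4 =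
        (2 * m + 1) ^ 2 + 3 * (2 * m + 1) + 2 + m * (m + 1) := by
      apply Nat.div_eq_of_eq_mul_left (by norm_num)
      have h : 8 * (2 * (m + 1) + 1) ≤ 5 * (2 * (m + 1) + 1) ^ 2 := by nlinarith
      zify [h]
      ring
    rw [OrthogonalExpSum.A₂minus, hexp, show (2 * (m + 1) + 1 - 1) / 2 = m + 1 by omega,
      show 2 * (m + 1) + 1 = 2 * m + 1 + 2 by ring, OrthogonalExpSum.traceSum_DC₂ hψ,
      (OrthogonalExpSum.symmCount_eq m).2, Rat.cast_mul, OrthogonalExpSum.cast_prod_Icc]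
    push_cast
    ring
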